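/- A Wang tile is written as a 4-tuple $(\text{right},\text{top},\text{left},\text{bottom})$ of edge colors. Let $\mathcal U=\{u_0,\dots,u_{18}\}$ be the set of the following 19 Wang tiles (with vertical-edge colors $A,\dots,J$ and horizontal-edge colors $K,\dots,P$), listed in the order $u_0,u_1,\dots,u_{18}$: $$\begin{array}{l}FOJO,\ FOHL,\ JMFP,\ DMFK,\ HPJP,\ HPHN,\ HKFP,\ HKDP,\ BOIO,\ GLEO,\\ GLCL,\ ALIO,\ EPGP,\ EPIP,\ IPGK,\ IPIK,\ IKBM,\ IKAK,\ CNIP.\end{array}$$ Let $\Omega_{\mathcal U}\subset\mathcal U^{\mathbb Z^2}$ be its Wang shift, i.e. the set of all maps $x:\mathbb Z^2\to\mathcal U$ such that $\text{right}(x(\mathbf n))=\text{left}(x(\mathbf n+\mathbf e_1))$ and $\text{top}(x(\mathbf n))=\text{bottom}(x(\mathbf n+\mathbf e_2))$ for all $\mathbf n\in\mathbb Z^2$, and let $(\sigma^{\mathbf n}x)_{\mathbf m}=x_{\mathbf m+\mathbf n}$ be the shift action. Let $\omega$ be the $2$-dimensional morphism that sends the tiles (written by their indices) to the following words (matrices are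 drawn with the Cartesian convention, bottom row at the bottom): $$\begin{array}{l} 0\mapsto 17,\quad 1\mapsto 16,\quad 2\mapsto (15\ \,11),\quad 3\mapsto(13\ \,9),\quad 4\mapsto(17\ \,8),\quad 5\mapsto(16\ \,8),\quad 6\mapsto(15\ \,8),\quad 7\mapsto(14\ \,8),\\[1mm] 8\mapsto\begin{pmatrix}6\\14\end{pmatrix},\quad 9\mapsto\begin{pmatrix}3\\17\end{pmatrix},\quad 10\mapsto\begin{pmatrix}3\\16\end{pmatrix},\quad 11\mapsto\begin{pmatrix}2\\14\end{pmatrix},\quad 12\mapsto\begin{pmatrix}7&1\\15&11\end{pmatrix},\quad 13\mapsto\begin{pmatrix}6&1\\14&11\end{pmatrix},\\[3mm] 14\mapsto\begin{pmatrix}7&1\\13&9\end{pmatrix},\quad 15\mapsto\begin{pmatrix}6&1\\12&9\end{pmatrix},\quad 16\mapsto\begin{pmatrix}5&1\\18&10\end{pmatrix},\quad 17\mapsto\begin{pmatrix}4&1\\13&9\end{pmatrix},\quad 18\mapsto\begin{pmatrix}2&0\\14&8\end{pmatrix}. \end{array}$$ The image of a word, or of a configuration $x\in\mathcal U^{\mathbb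 Z^2}$, under such a morphism is the concatenation of the images of its letters (for a configuration, the lower left corner of the image of $x_{\mathbf 0}$ is placed at the origin); it is well-defined if the images of letters in a common column have the same width and the images of letters in a common row have the same height. A morphism $\varphi$ is expansive if for every letter $a$ and every $K\in\mathbb N$ there is $m$ such that both dimensions of $\varphi^m(a)$ exceed $K$. It is recognizable in $X$ if every configuration $y$ has at most one representation $y=\sigma^{\mathbf k}\varphi(x)$ with $x\in X$ and $\mathbf 0\le\mathbf k<\operatorname{shape}(\varphi(x_{\mathbf 0}))$ coordinate-wise. Write $\overline{\varphi(X)}^{\sigma}=\{\sigma^{\mathbf k}\varphi(x):\mathbf k\in\mathbb Z^2,\ x\in X\}$. A subshift (closed shift-invariant set) $X$ is self-similar if $X=\overline{\varphi(X)}^{\sigma}$ for some expansive morphism $\varphi$ that is well-defined on $X$. It is aperiodic if it is nonempty and no $x\in X$ satisfies $\sigma^{\mathbf n}x=x$ for some $\mathbf n\ne\mathbf 0$. **Corollary.** The morphism $\omega$ is well-defined on $\Omega_{\mathcal U}$ and maps $\Omega_{\mathcal U}$ into itself, and $$\overline{\omega(\Omega_{\mathcal U})}^{\sigma}=\Omega_{\mathcal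 U}.$$ Thus $\Omega_{\mathcal U}$ is self-similar. Moreover $\omega$ is expansive and recognizable in $\Omega_{\mathcal U}$, and $\Omega_{\mathcal U}$ is aperiodic. -/

import Mathlib

namespace WangShift

/-! ## Two-dimensional words -/

/-- A two-dimensional word of shape `(width, height)`. Cartesian coordinates are used: `letter i j`
is the letter in column `i` (from the left) and row `j` (from the bottom). -/
structure Word2 (A : Type*) where
  width : ℕ
  height : ℕ
  letter : Fin width → Fin height → A

namespace Word2

/-- The word of shape `(1, 1)`. -/
def single {A : Type*} (a : A) : Word2 A := ⟨1, 1, fun _ _ => a⟩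

/-- The horizontal domino of shape `(2, 1)` with `a` on the left and `b` on the right. -/
def hdom {A : Type*} (a b : A) : Word2 A := ⟨2, 1, fun i _ => ![a, b] i⟩

/-- The vertical domino of shape `(1, 2)` with `a` at the bottom and `b` on top. -/
def vdom {A : Type*} (a b : A) : Word2 A := ⟨1, 2, fun _ j => ![a, b] j⟩

/-- The word of shape `(2, 2)` whose left column is `a`, `b` and whose right column is `c`, `d`,
both read from bottom to top. -/
def square {A : Type*} (a b c d : A) : Word2 A := ⟨2, 2, fun i j => ![![a, b], ![c, d]] i j⟩

/-- `u` occurs in `v` at position `(p, q)`. -/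
def OccursAt {A : Type*} (u v : Word2 A) (p q : ℕ) : Prop :=
  ∃ (hw : p + u.width ≤ v.width) (hh : q + u.height ≤ v.height),
    ∀ (i : Fin u.width) (j : Fin u.height),
      v.letter ⟨p + i, by have := i.isLt; omega⟩ ⟨q + j, by have := j.isLt; omega⟩ = u.letter i j

end Word2

/-! ## Configurations, the shift action, subshifts -/

/-- A configuration `ℤ² → A`. -/
abbrev Config (A : Type*) := ℤ × ℤ → A

/-- The shift action of `ℤ²`: `(σⁿ x)ₘ = xₘ₊ₙ`. -/
def shift {A : Type*} (n : ℤ × ℤ) (x : Config A) : Config A := fun m => x (m + n)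

/-- A subshift: a shift-invariant set, closed for the product of the discrete topologies. -/
def IsSubshift {A : Type*} (X : Set (Config A)) : Prop :=
  (∀ n : ℤ × ℤ, shift n '' X = X) ∧
    @IsClosed (Config A) (@Pi.topologicalSpace (ℤ × ℤ) (fun _ => A) (fun _ => ⊥)) X

/-- A set of configurations is aperiodic if it is nonempty and none of its elements has a nonzero
period. -/
def IsAperiodic {A : Type*} (X : Set (Config A)) : Prop :=
  X.Nonempty ∧ ∀ x ∈ X, ∀ n : ℤ × ℤ, n ≠ 0 → shift n x ≠ x

/-- `u` occurs in the configuration `x` at position `p`. -/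
def OccursInConfig {A : Type*} (u : Word2 A) (x : Config A) (p : ℤ × ℤ) : Prop :=
  ∀ (i : Fin u.width) (j : Fin u.height), x (p + ((i : ℤ), (j : ℤ))) = u.letter i j

/-! ## Two-dimensional morphisms

A two-dimensional morphism is given by the images `φ a` of the letters. The image of a word (or of
a configuration) is obtained by concatenating the images of its letters. It is well-defined when the
letters of a common column have images of the same width and the letters of a common row have images
of the same height. -/

/-- `v = φ(u)`: the word `v` is the concatenation, in both directions, of the words `φ (u i j)`.
Here `c i` is the total width of the images of the columns before `i`, and `r j` is the total height
of the images of the rows before `j`. -/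
def IsWordImage {A B : Type*} (φ : A → Word2 B) (u : Word2 A) (v : Word2 B) : Prop :=
  ∃ c r : ℕ → ℕ, c 0 = 0 ∧ r 0 = 0 ∧ v.width = c u.width ∧ v.height = r u.height ∧
    ∀ (i : Fin u.width) (j : Fin u.height),
      c (i + 1) = c i + (φ (u.letter i j)).width ∧
      r (j + 1) = r j + (φ (u.letter i j)).height ∧
      (φ (u.letter i j)).OccursAt v (c i) (r j)

/-- `y = φ(x)` for configurations: `y` is the concatenation of the words `φ (x (i, j))`, the lower
left corner of `φ (x (0, 0))` being placed at the origin. -/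
def IsConfigImage {A B : Type*} (φ : A → Word2 B) (x : Config A) (y : Config B) : Prop :=
  ∃ c r : ℤ → ℤ, c 0 = 0 ∧ r 0 = 0 ∧
    ∀ i j : ℤ,
      c (i + 1) = c i + (φ (x (i, j))).width ∧
      r (j + 1) = r j + (φ (x (i, j))).height ∧
      OccursInConfig (φ (x (i, j))) y (c i, r j)

/-- `w = φᵐ(a)`. -/
def IsIterate {A : Type*} (φ : A → Word2 A) (a : A) : ℕ → Word2 A → Prop
  | 0, w => w = Word2.single a
  | m + 1, w => ∃ u, IsIterate φ a m u ∧ IsWordImage φ u w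

/-- `φ` is expansive: for every letter `a` and every `K` there is `m` such that
`min (shape (φᵐ(a))) > K`. -/
def IsExpansive {A : Type*} (φ : A → Word2 A) : Prop :=
  ∀ (a : A) (K : ℕ), ∃ (m : ℕ) (w : Word2 A), IsIterate φ a m w ∧ K < min w.width w.height

/-- `φ` is a well-defined morphism from `X` to `Y`: every `x ∈ X` has exactly one image, and this
image belongs to `Y`. -/
def IsMorphism {A B : Type*} (φ : A → Word2 B) (X : Set (Config A)) (Y : Set (Config B)) : Prop :=
  ∀ x ∈ X, ∃ y ∈ Y, IsConfigImage φ x y ∧ ∀ z, IsConfigImage φ x z → z = y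

/-- `(k, x)` is a `φ`-representation of `y`: `y = σᵏ(φ(x))`. -/
def IsRepresentation {A B : Type*} (φ : A → Word2 B) (k : ℤ × ℤ) (x : Config A) (y : Config B) :
    Prop :=
  ∃ z, IsConfigImage φ x z ∧ y = shift k z

/-- The closure of `φ(X)` under the shift: all `σᵏ(φ(x))` with `k ∈ ℤ²` and `x ∈ X`. -/
def imageShiftClosure {A B : Type*} (φ : A → Word2 B) (X : Set (Config A)) : Set (Config B) :=
  {y | ∃ k : ℤ × ℤ, ∃ x ∈ X, IsRepresentation φ k x y}

/-- A centered representation: `0 ≤ k < shape (φ(x₀))` coordinate-wise. -/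
def IsCenteredRepresentation {A B : Type*} (φ : A → Word2 B) (k : ℤ × ℤ) (x : Config A)
    (y : Config B) : Prop :=
  IsRepresentation φ k x y ∧
    0 ≤ k.1 ∧ k.1 < (φ (x 0)).width ∧ 0 ≤ k.2 ∧ k.2 < (φ (x 0)).height

/-- `φ` is recognizable in `X`: every configuration has at most one centered `φ`-representation
`(k, x)` with `x ∈ X`. -/
def IsRecognizable {A B : Type*} (φ : A → Word2 B) (X : Set (Config A)) : Prop :=
  ∀ (y : Config B) (k k' : ℤ × ℤ) (x x' : Config A), x ∈ X → x' ∈ X →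
    IsCenteredRepresentation φ k x y → IsCenteredRepresentation φ k' x' y → k = k' ∧ x = x'

/-- A subshift `X` is self-similar if `X` is the shift-closure of `φ(X)` for some expansive
morphism `φ` (which is well-defined on `X`). -/
def IsSelfSimilar {A : Type*} (X : Set (Config A)) : Prop :=
  IsSubshift X ∧ ∃ φ : A → Word2 A, IsExpansive φ ∧ IsMorphism φ X X ∧ imageShiftClosure φ X = X

/-! ## Wang tiles -/

/-- A Wang tile: `I` is the set of colors of the vertical (right and left) edges and `J` the set of
colors of the horizontal (top and bottom) edges. -/
structure Tile (I J : Type*) where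
  right : I
  top : J
  left : I
  bottom : J

/-- The Wang shift of a tile set `{T a}` indexed by `a`: all valid tilings of `ℤ²`. -/
def tilings {ι I J : Type*} (T : ι → Tile I J) : Set (Config ι) :=
  {x | ∀ n : ℤ × ℤ, (T (x n)).right = (T (x (n + (1, 0)))).left ∧
    (T (x n)).top = (T (x (n + (0, 1)))).bottom}

/-- The ten colors of the vertical edges. -/
inductive VColor
  | A | B | C | D | E | F | G | H | I | J

/-- The six colors of the horizontal edges. -/
inductive HColor
  | K | L | M | N | O | P

open VColor HColor in
/-- The tiles `u₀, …, u₁₈`, each given as (right, top, left, bottom). -/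
def tileU : Fin 19 → Tile VColor HColor :=
  ![⟨F, O, J, O⟩, ⟨F, O, H, L⟩, ⟨J, M, F, P⟩, ⟨D, M, F, K⟩, ⟨H, P, J, P⟩,
    ⟨H, P, H, N⟩, ⟨H, K, F, P⟩, ⟨H, K, D, P⟩, ⟨B, O, I, O⟩, ⟨G, L, E, O⟩,
    ⟨G, L, C, L⟩, ⟨A, L, I, O⟩, ⟨E, P, G, P⟩, ⟨E, P, I, P⟩, ⟨I, P, G, K⟩,
    ⟨I, P, I, K⟩, ⟨I, K, B, M⟩, ⟨I, K, A, K⟩, ⟨C, N, I, P⟩]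

/-- The nineteen tiles are pairwise distinct, so that a tile can be identified with its index. -/
theorem tileU_injective : Function.Injective tileU := by
  intro a b h
  fin_cases a <;> fin_cases b <;> first | rfl | (simp [tileU] at h)

/-- The Wang shift `Ω_𝒰`. -/
def OmegaU : Set (Config (Fin 19)) := tilings tileU

/-! ## The morphism `ω = α ∘ β ∘ γ` -/

open Word2

/-- The morphism `α` from the 21-letter alphabet `v₀, …, v₂₀` to words over `𝒰`: letters are sent
to letters or to vertical dominoes. -/
def alpha : Fin 21 → Word2 (Fin 19) :=
  ![single 11, single 8, single 13, single 9, single 17, single 16, single 14, single 15,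
    vdom 11 1, vdom 8 0, vdom 18 5, vdom 12 6, vdom 13 7, vdom 13 4, vdom 10 1,
    vdom 9 1, vdom 17 3, vdom 16 3, vdom 14 6, vdom 15 7, vdom 14 2]

/-- The morphism `β` from the 19-letter alphabet `w₀, …, w₁₈` to words over `v₀, …, v₂₀`: letters
are sent to letters or to horizontal dominoes. -/
def beta : Fin 19 → Word2 (Fin 21) :=
  ![single 4, single 5, hdom 7 0, hdom 2 3, hdom 4 1, hdom 5 1, hdom 7 1, hdom 6 1,
    single 18, single 16, single 17, single 20, hdom 19 8, hdom 18 8, hdom 12 15,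
    hdom 11 15, hdom 10 14, hdom 13 15, hdom 20 9]

/-- The letter-to-letter bijection `uᵢ ↦ wᵢ`; on indices it is the identity. -/
def gamma : Fin 19 → Fin 19 := id

/-- The images `ω(u₀), …, ω(u₁₈)`. -/
def omega : Fin 19 → Word2 (Fin 19) :=
  ![single 17, single 16, hdom 15 11, hdom 13 9, hdom 17 8, hdom 16 8, hdom 15 8, hdom 14 8,
    vdom 14 6, vdom 17 3, vdom 16 3, vdom 14 2, square 15 7 11 1, square 14 6 11 1,
    square 13 7 9 1, square 12 6 9 1, square 18 5 10 1, square 13 4 9 1, square 14 2 8 0]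

/-- `ω = α ∘ β ∘ γ`. -/
theorem omega_eq_comp (i : Fin 19) : IsWordImage alpha (beta (gamma i)) (omega i) := by
  have hc : ∀ i, (beta i).height = 1 := by decide
  have key : ∀ i, (omega i).width = (beta i).width ∧
      ∃ h : ℕ, (omega i).height = h ∧
      ∀ (p : Fin (beta i).width) (q : Fin (beta i).height),
        (alpha ((beta i).letter p q)).width = 1 ∧ (alpha ((beta i).letter p q)).height = h ∧
        ∃ (hw : p + (alpha ((beta i).letter p q)).width ≤ (omega i).width)
          (hh : 0 + (alpha ((beta i).letter p q)).height ≤ (omega i).height),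
          ∀ (a : Fin (alpha ((beta i).letter p q)).width)
            (b : Fin (alpha ((beta i).letter p q)).height),
            (omega i).letter ⟨p + a, by have := a.isLt; omega⟩ ⟨0 + b, by have := b.isLt; omega⟩
              = (alpha ((beta i).letter p q)).letter a b := by
    intro i
    refine ⟨?_, _, rfl, ?_⟩ <;> revert i <;> decide
  obtain ⟨h1, h, h2, h3⟩ := key i
  refine ⟨fun n => n, fun n => n * h, rfl, by simp, h1, by simp [gamma, hc, h2], ?_⟩
  intro p q
  obtain ⟨e1, e2, e3⟩ := h3 p q
  have hq : (q : ℕ) = 0 := by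
    have := q.isLt
    have h' : (beta (gamma i)).height = 1 := hc i
    omega
  refine ⟨by rw [show (alpha ((beta (gamma i)).letter p q)).width = 1 from e1],
    by rw [show (alpha ((beta (gamma i)).letter p q)).height = h from e2]; ring, ?_⟩
  have h0 : (q : ℕ) * h = 0 := by simp [hq]
  simp only [h0]
  exact e3

end WangShift

/-!
Call a tile *wide* if its image under `ω` has two columns and *tall* if it has two rows. The colors
of the tiles make these properties constant along columns and rows of a tiling, and the colors on
the border of `ω(u)` depend only on those of `u`; hence `ω` is well-defined on `Ω_𝒰` and maps
tilings to tilings. Inside an image `ω(u)`, exactly the letters of the left column are wide and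
exactly those of the bottom row are tall. So a configuration `ω(x)` is cut into the images of the
letters of `x` at its wide columns and tall rows (`IsImage.enumerates_col`). This determines the
offset of a centered representation and all cut positions, and `ω` is injective on letters, which
gives recognizability (`IsImage.preimage_unique`, `centered_offset`).

Conversely, every tiling is cut in this way. No two narrow tiles are horizontally adjacent
(`wide_or_wide_of_hMatch`), two short tiles on top of each other do not extend to a `5 × 2`
rectangle (`tall_or_tall_of_row`), and a `4 × 3` neighbourhood of a wide and tall tile forces it to
be the lower left corner of some `ω(u)` (`exists_isBlock`); these are finite checks. As border
colors of images determine those of the letters, the letters `u` obtained form a tiling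
(`exists_isImage`), so that `Ω_𝒰` is the shift-closure of `ω(Ω_𝒰)`.

A period `(a, b)` of `ω(x)` permutes the cuts, and comes from a period `(a', b')` of `x`. Because
one of any two consecutive columns of `x` is wide, `|a'| < |a|` unless `a = a' = 0`, and likewise
for the rows (`Enumerates.period_lt`); by descent a tiling has no nonzero period. Expansivity holds
because from the first iterate on the lower left letter is wide and tall, so that each dimension
grows by at least one at every step (`exists_isIterate`). As the iterated images of a letter consist
of matching tiles, compactness yields a tiling.
-/

namespace WangShift

/-! ### Local combinatorics of the tiles and of the images `ω(uᵢ)` -/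

instance : DecidableEq VColor := fun a b =>
  decidable_of_iff (a.ctorIdx = b.ctorIdx)
    ⟨by cases a <;> cases b <;> simp [VColor.ctorIdx], fun h => h ▸ rfl⟩

instance : DecidableEq HColor := fun a b =>
  decidable_of_iff (a.ctorIdx = b.ctorIdx)
    ⟨by cases a <;> cases b <;> simp [HColor.ctorIdx], fun h => h ▸ rfl⟩

/-- The tile `u_b` may be placed immediately to the right of `u_a`. -/
abbrev HMatch (a b : Fin 19) : Prop := (tileU a).right = (tileU b).left

/-- The tile `u_b` may be placed immediately above `u_a`. -/
abbrev VMatch (a b : Fin 19) : Prop := (tileU a).top = (tileU b).bottom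

/-- The image of the tile has two columns. -/
abbrev Wide (a : Fin 19) : Prop := (omega a).width = 2

/-- The image of the tile has two rows. -/
abbrev Tall (a : Fin 19) : Prop := (omega a).height = 2

/-- The letter of `ω(u_a)` in column `p` and row `q`; the value outside of the shape of `ω(u_a)`
is irrelevant. -/
def img (a : Fin 19) (p q : ℕ) : Fin 19 :=
  if h : p < (omega a).width ∧ q < (omega a).height then (omega a).letter ⟨p, h.1⟩ ⟨q, h.2⟩ else 0

theorem width_omega (a : Fin 19) : (omega a).width = 1 ∨ (omega a).width = 2 := by
  revert a; decide

theorem height_omega (a : Fin 19) : (omega a).height = 1 ∨ (omega a).height = 2 := by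
  revert a; decide

theorem height_eq_of_hMatch : ∀ a b, HMatch a b → (omega a).height = (omega b).height := by
  decide +kernel

theorem width_eq_of_vMatch : ∀ a b, VMatch a b → (omega a).width = (omega b).width := by
  decide +kernel

/-- The position of a letter inside of an image is visible on the letter itself: exactly the letters
of the left column are wide. -/
theorem wide_img : ∀ a, ∀ p < (omega a).width, ∀ q < (omega a).height,
    (Wide (img a p q) ↔ p = 0) := by
  decide +kernel

/-- Exactly the letters of the bottom row of an image are tall. -/
theorem tall_img : ∀ a, ∀ p < (omega a).width, ∀ q < (omega a).height,
    (Tall (img a p q) ↔ q = 0) := by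
  decide +kernel

theorem hMatch_img : ∀ a, ∀ p < (omega a).width, ∀ q < (omega a).height,
    p + 1 < (omega a).width → HMatch (img a p q) (img a (p + 1) q) := by
  decide +kernel

theorem vMatch_img : ∀ a, ∀ p < (omega a).width, ∀ q < (omega a).height,
    q + 1 < (omega a).height → VMatch (img a p q) (img a p (q + 1)) := by
  decide +kernel

theorem hMatch_img_img : ∀ a b, HMatch a b → ∀ p < (omega a).width, ∀ q < (omega a).height,
    p + 1 = (omega a).width → HMatch (img a p q) (img b 0 q) := by
  decide +kernel

theorem vMatch_img_img : ∀ a b, VMatch a b → ∀ p < (omega a).width, ∀ q < (omega a).height,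
    q + 1 = (omega a).height → VMatch (img a p q) (img b p 0) := by
  decide +kernel

theorem hMatch_of_img : ∀ a b, (omega a).height = (omega b).height →
    (∀ q < (omega a).height, HMatch (img a ((omega a).width - 1) q) (img b 0 q)) →
    HMatch a b := by
  decide +kernel

theorem vMatch_of_img : ∀ a b, (omega a).width = (omega b).width →
    (∀ p < (omega a).width, VMatch (img a p ((omega a).height - 1)) (img b p 0)) →
    VMatch a b := by
  decide +kernel

theorem img_injective : ∀ a b, (omega a).width = (omega b).width →
    (omega a).height = (omega b).height →
    (∀ p < (omega a).width, ∀ q < (omega a).height, img a p q = img b p q) → a = b := by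
  decide +kernel

theorem wide_or_wide_of_hMatch : ∀ a b, HMatch a b → Wide a ∨ Wide b := by
  decide +kernel

/-- Two short tiles on top of each other do not extend to a `5 × 2` rectangle. -/
theorem tall_or_tall_of_row :
    ∀ a₀ b₀, VMatch a₀ b₀ → ¬ Tall a₀ → ¬ Tall b₀ →
    ∀ a₁, HMatch a₀ a₁ → ∀ b₁, HMatch b₀ b₁ → VMatch a₁ b₁ →
    ∀ a₂, HMatch a₁ a₂ → ∀ b₂, HMatch b₁ b₂ → VMatch a₂ b₂ →
    ∀ a₃, HMatch a₂ a₃ → ∀ b₃, HMatch b₂ b₃ → VMatch a₃ b₃ →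
    ∀ a₄, HMatch a₃ a₄ → ∀ b₄, HMatch b₃ b₄ → ¬ VMatch a₄ b₄ := by
  decide +kernel

/-- The square `t, u` (left column, read upwards), `r, d` (right column) starts with `ω(u_a)`, the
width and height of which are told by whether `r` is wide and `u` is tall. -/
abbrev IsBlock (a t u r d : Fin 19) : Prop :=
  (omega a).width = (if Wide r then 1 else 2) ∧ (omega a).height = (if Tall u then 1 else 2) ∧
  ∀ p < (omega a).width, ∀ q < (omega a).height,
    img a p q = ![![t, u], ![r, d]] (Fin.ofNat 2 p) (Fin.ofNat 2 q)

/-- In the middle of a valid `4 × 3` rectangle with columns `bᵢ cᵢ dᵢ` (read upwards), a wide and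
tall tile `c₁` is the lower left corner of the image of some tile: if the right and upper neighbours
of `c₁` do not complete such an image, then the rectangle cannot be completed. -/
theorem exists_isBlock :
    ∀ c₁, Wide c₁ → Tall c₁ → ∀ c₂, HMatch c₁ c₂ → ∀ d₁, VMatch c₁ d₁ →
    ∀ d₂, HMatch d₁ d₂ → VMatch c₂ d₂ →
    (∃ a, IsBlock a c₁ d₁ c₂ d₂) ∨
    ∀ c₀, HMatch c₀ c₁ → ∀ d₀, HMatch d₀ d₁ → VMatch c₀ d₀ →
    ∀ b₁, VMatch b₁ c₁ → ∀ b₀, HMatch b₀ b₁ → VMatch b₀ c₀ →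
    ∀ b₂, HMatch b₁ b₂ → VMatch b₂ c₂ →
    ∀ c₃, HMatch c₂ c₃ → ∀ d₃, HMatch d₂ d₃ → VMatch c₃ d₃ →
    ∀ b₃, HMatch b₂ b₃ → ¬ VMatch b₃ c₃ := by
  decide +kernel

/-! ### Enumerating cut positions on a line -/

/-- The bi-infinite sequence `c` lists positions at which `P` holds, in increasing order and with
gaps `1` or `2`; the position inside of a gap `2` does not satisfy `P`, so `c` omits no position. -/
def Enumerates (P : ℤ → Prop) (c : ℤ → ℤ) : Prop :=
  ∀ i, P (c i) ∧ (c (i + 1) = c i + 1 ∨ c (i + 1) = c i + 2 ∧ ¬ P (c i + 1))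

theorem exists_orbit {α : Type*} (e : Equiv.Perm α) (s : α) :
    ∃ c : ℤ → α, c 0 = s ∧ ∀ i, c (i + 1) = e (c i) :=
  ⟨fun i => (e ^ i) s, by simp, fun i => by
    simp only [add_comm i 1, zpow_add, zpow_one, Equiv.Perm.mul_apply]⟩

theorem exists_partialSums (w : ℤ → ℤ) : ∃ c : ℤ → ℤ, c 0 = 0 ∧ ∀ i, c (i + 1) = c i + w i := by
  -- The sums are read off an orbit of the permutation `(i, s) ↦ (i + 1, s + w i)`.
  let e : Equiv.Perm (ℤ × ℤ) :=
    { toFun := fun s => (s.1 + 1, s.2 + w s.1)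
      invFun := fun s => (s.1 - 1, s.2 - w (s.1 - 1))
      left_inv := fun s => by simp
      right_inv := fun s => by simp }
  obtain ⟨c, h0, h1⟩ := exists_orbit e (0, 0)
  have hfst : ∀ i, (c i).1 = i := by
    intro i
    induction i using Int.induction_on with
    | zero => simp [h0]
    | succ i ih => rw [h1]; simp [e, ih]
    | pred i ih =>
      have h := congrArg Prod.fst (h1 (-(i : ℤ) - 1))
      simp only [sub_add_cancel, ih, e, Equiv.coe_fn_mk] at h
      lia
  refine ⟨fun i => (c i).2, by simp [h0], fun i => ?_⟩
  simp [h1, e, hfst]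

open Classical in
theorem exists_enumerates {P : ℤ → Prop} (hP : ∀ n, P n ∨ P (n + 1)) (h0 : P 0) :
    ∃ c, c 0 = 0 ∧ Enumerates P c := by
  -- `e` sends each position satisfying `P` to the next one.
  let e : Equiv.Perm {n // P n} :=
    { toFun := fun n => if h : P (n + 1) then ⟨n + 1, h⟩ else
        ⟨n + 2, by have := (hP (n + 1)).resolve_left h; rwa [add_assoc] at this⟩
      invFun := fun n => if h : P (n - 1) then ⟨n - 1, h⟩ else
        ⟨n - 2, by
          have := (hP (n - 2)).resolve_right (by rwa [show (n : ℤ) - 2 + 1 = n - 1 by ring])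
          exact this⟩
      left_inv := fun n => by
        obtain ⟨n, hn⟩ := n
        by_cases h : P (n + 1)
        · simp [h, hn]
        · have h' : ¬ P (n + 2 - 1) := by rwa [show n + 2 - 1 = n + 1 by ring]
          simp [h, h']
      right_inv := fun n => by
        obtain ⟨n, hn⟩ := n
        by_cases h : P (n - 1)
        · simp [h, hn]
        · have h' : ¬ P (n - 2 + 1) := by rwa [show n - 2 + 1 = n - 1 by ring]
          simp [h, h'] }
  obtain ⟨c, hc0, hc⟩ := exists_orbit e ⟨0, h0⟩
  refine ⟨fun i => c i, by simp [hc0], fun i => ⟨(c i).2, ?_⟩⟩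
  by_cases h : P (c i + 1)
  · left; simp [hc, e, h]
  · right; simp [hc, e, h]

namespace Enumerates

variable {P : ℤ → Prop} {c c' : ℤ → ℤ}

/-- An enumeration is determined by its first value. -/
theorem unique (h : Enumerates P c) (h' : Enumerates P c') (h0 : c 0 = c' 0) : c = c' := by
  funext i
  induction i using Int.induction_on with
  | zero => exact h0
  | succ i ih =>
    obtain ⟨-, h1⟩ := h i
    obtain ⟨-, h1'⟩ := h' i
    have h2 := (h (i + 1)).1
    have h2' := (h' (i + 1)).1
    grind
  | pred i ih =>
    obtain ⟨h2, h1⟩ := h (-(i : ℤ) - 1)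
    obtain ⟨h2', h1'⟩ := h' (-(i : ℤ) - 1)
    simp only [sub_add_cancel] at h1 h1'
    grind

theorem comp_add (h : Enumerates P c) (a : ℤ) : Enumerates P fun i => c (i + a) := by
  intro i
  have := h (i + a)
  rwa [show i + a + 1 = i + 1 + a by ring] at this

theorem add_le (h : Enumerates P c) (i : ℤ) (n : ℕ) : c i + n ≤ c (i + n) := by
  induction n with
  | zero => simp
  | succ n ih =>
    have := (h (i + n)).2
    push_cast
    rw [← add_assoc i]
    lia

theorem strictMono (h : Enumerates P c) : StrictMono c :=
  strictMono_int_of_lt_succ fun i => by have := (h i).2; lia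

end Enumerates

/-- Every position lies in a gap of an increasing sequence of cut positions. -/
theorem exists_gap {c : ℤ → ℤ} (hc : StrictMono c) (n : ℤ) :
    ∃ i, c i ≤ n ∧ n < c (i + 1) := by
  have hup : ∀ k : ℕ, c 0 + k ≤ c k := fun k => by
    induction k with
    | zero => simp
    | succ k ih => have := hc (show (k : ℤ) < (k + 1 : ℕ) by simp); push_cast at *; lia
  have hdown : ∀ k : ℕ, c (-k) ≤ c 0 - k := fun k => by
    induction k with
    | zero => simp
    | succ k ih => have := hc (show (-(k + 1 : ℕ) : ℤ) < -k by simp); push_cast at *; lia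
  obtain ⟨i, hi, hmax⟩ := Int.exists_greatest_of_bdd (P := fun i => c i ≤ n)
    ⟨(n - c 0).natAbs, fun z hz => by
      by_contra! hlt
      have := hup (n - c 0).natAbs
      have := hc hlt
      lia⟩
    ⟨-(n - c 0).natAbs, by have := hdown (n - c 0).natAbs; lia⟩
  refine ⟨i, hi, ?_⟩
  by_contra! hle
  have := hmax _ hle
  lia

theorem gap_unique {c : ℤ → ℤ} (hc : StrictMono c) {n i i' : ℤ} (h1 : c i ≤ n)
    (h2 : n < c (i + 1)) (h1' : c i' ≤ n) (h2' : n < c (i' + 1)) : i = i' := by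
  have := hc.lt_iff_lt.1 (h1.trans_lt h2')
  have := hc.lt_iff_lt.1 (h1'.trans_lt h2)
  lia

namespace Enumerates

variable {P : ℤ → Prop} {c : ℤ → ℤ}

theorem exists_eq (h : Enumerates P c) {n : ℤ} (hn : P n) : ∃ i, c i = n := by
  obtain ⟨i, h1, h2⟩ := exists_gap h.strictMono n
  refine ⟨i, ?_⟩
  obtain h3 | ⟨h3, h4⟩ := (h i).2
  · lia
  · obtain h5 | h5 : n = c i ∨ n = c i + 1 := by lia
    · exact h5.symm
    · exact absurd (h5 ▸ hn) h4

/-- If `P` has the period `a`, then `c` carries some period `a'` of the indices to `a`. -/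
theorem exists_period (h : Enumerates P c) (h0 : c 0 = 0) {a : ℤ} (ha : ∀ n, P (n + a) ↔ P n) :
    ∃ a', ∀ i, c (i + a') = c i + a := by
  obtain ⟨a', ha'⟩ := h.exists_eq (n := a) (by simpa [h0] using (ha 0).2 (h0 ▸ (h 0).1))
  refine ⟨a', fun i => ?_⟩
  have h2 : Enumerates P fun i => c i + a := fun i => by
    have h3 := h i
    refine ⟨(ha _).2 h3.1, ?_⟩
    rw [show c i + a + 1 = c i + 1 + a by ring, ha]
    obtain h4 | h4 := h3.2
    · left; lia
    · right; exact ⟨by lia, h4.2⟩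
  exact congrFun ((h.comp_add a').unique h2 (by simp [h0, ha'])) i

/-- Desubstitution shrinks nonzero periods: among any two consecutive gaps one has length `2`. -/
theorem period_lt (h : Enumerates P c) (h0 : c 0 = 0) (h2 : ∀ i, c i + 3 ≤ c (i + 2)) {a a' : ℤ}
    (ha : ∀ i, c (i + a') = c i + a) : a = 0 ∧ a' = 0 ∨ a ≠ 0 ∧ a' ≠ 0 ∧ a'.natAbs < a.natAbs := by
  have e1 : c a' = a := by simpa [h0] using ha 0
  have e2 : c (a' + a') = a + a := by rw [ha, e1]
  have e3 := h2 0
  have e4 := h2 (-2)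
  simp only [h0, zero_add, Int.reduceNeg, neg_add_cancel] at e3 e4
  rcases lt_trichotomy a' 0 with hn | rfl | hp
  · obtain rfl | hn : a' = -1 ∨ a' ≤ -2 := by lia
    · simp only [Int.reduceNeg, Int.reduceAdd] at e2
      lia
    · have := h.add_le a' (-2 - a').toNat
      rw [show a' + ((-2 - a').toNat : ℤ) = -2 by lia] at this
      lia
  · left; exact ⟨by rw [← e1, h0], rfl⟩
  · obtain rfl | hn : a' = 1 ∨ 2 ≤ a' := by lia
    · simp only [Int.reduceAdd] at e2
      lia
    · have := h.add_le 2 (a' - 2).toNat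
      rw [show 2 + ((a' - 2).toNat : ℤ) = a' by lia] at this
      lia

end Enumerates

/-! ### Images of configurations under `ω` -/

/-- `y = ω(x)`, the columns and rows of the image being cut at the positions `c i` and `r j`. -/
structure IsImage (x y : Config (Fin 19)) (c r : ℤ → ℤ) : Prop where
  col_zero : c 0 = 0
  row_zero : r 0 = 0
  col_succ (i j : ℤ) : c (i + 1) = c i + (omega (x (i, j))).width
  row_succ (i j : ℤ) : r (j + 1) = r j + (omega (x (i, j))).height
  letter (i j : ℤ) (p q : ℕ) (hp : p < (omega (x (i, j))).width)
    (hq : q < (omega (x (i, j))).height) : y (c i + p, r j + q) = img (x (i, j)) p q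

theorem img_eq_letter (a : Fin 19) (i : Fin (omega a).width) (j : Fin (omega a).height) :
    img a i j = (omega a).letter i j := by
  simp [img]

theorem isConfigImage_omega_iff {x y : Config (Fin 19)} :
    IsConfigImage omega x y ↔ ∃ c r, IsImage x y c r := by
  constructor
  · rintro ⟨c, r, hc, hr, h⟩
    refine ⟨c, r, hc, hr, fun i j => (h i j).1, fun i j => (h i j).2.1, fun i j p q hp hq => ?_⟩
    have := (h i j).2.2 ⟨p, hp⟩ ⟨q, hq⟩
    rw [← img_eq_letter] at this
    simpa using this
  · rintro ⟨c, r, h⟩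
    refine ⟨c, r, h.col_zero, h.row_zero, fun i j => ⟨h.col_succ i j, h.row_succ i j,
      fun p q => ?_⟩⟩
    rw [← img_eq_letter]
    simpa using h.letter i j p q p.2 q.2

/-- The letters of a common column have images of the same width, and the letters of a common row
have images of the same height. -/
def IsConsistent (x : Config (Fin 19)) : Prop :=
  ∀ i j, (omega (x (i, j + 1))).width = (omega (x (i, j))).width ∧
    (omega (x (i + 1, j))).height = (omega (x (i, j))).height

theorem apply_eq_apply_zero {f : ℤ → ℕ} (h : ∀ i, f (i + 1) = f i) (i : ℤ) : f i = f 0 := by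
  induction i using Int.induction_on with
  | zero => rfl
  | succ i ih => rw [h, ih]
  | pred i ih => rw [← ih, ← h (-(i : ℤ) - 1), sub_add_cancel]

namespace IsConsistent

variable {x : Config (Fin 19)}

theorem width_eq (hx : IsConsistent x) (i j : ℤ) :
    (omega (x (i, j))).width = (omega (x (i, 0))).width :=
  apply_eq_apply_zero (f := fun j => (omega (x (i, j))).width) (fun j => (hx i j).1) j

theorem height_eq (hx : IsConsistent x) (i j : ℤ) :
    (omega (x (i, j))).height = (omega (x (0, j))).height :=
  apply_eq_apply_zero (f := fun i => (omega (x (i, j))).height) (fun i => (hx i j).2) i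

theorem exists_image (hx : IsConsistent x) : ∃ y c r, IsImage x y c r := by
  obtain ⟨c, hc0, hc⟩ := exists_partialSums fun i => (omega (x (i, 0))).width
  obtain ⟨r, hr0, hr⟩ := exists_partialSums fun j => (omega (x (0, j))).height
  have hcm : StrictMono c := strictMono_int_of_lt_succ fun i => by
    have := hc i; have := width_omega (x (i, 0)); lia
  have hrm : StrictMono r := strictMono_int_of_lt_succ fun j => by
    have := hr j; have := height_omega (x (0, j)); lia
  choose f hf1 hf2 using exists_gap hcm
  choose g hg1 hg2 using exists_gap hrm
  refine ⟨fun n => img (x (f n.1, g n.2)) (n.1 - c (f n.1)).toNat (n.2 - r (g n.2)).toNat, c, r,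
    hc0, hr0, fun i j => by rw [hc, hx.width_eq i j], fun i j => by rw [hr, hx.height_eq i j], ?_⟩
  intro i j p q hp hq
  have hw := hx.width_eq i j
  have hh := hx.height_eq i j
  have e1 : f (c i + p) = i := gap_unique hcm (hf1 _) (hf2 _) (by lia) (by rw [hc]; lia)
  have e2 : g (r j + q) = j := gap_unique hrm (hg1 _) (hg2 _) (by lia) (by rw [hr]; lia)
  simp [e1, e2]

end IsConsistent

namespace IsImage

variable {x x' y : Config (Fin 19)} {c r c' r' : ℤ → ℤ}

theorem wide_iff (h : IsImage x y c r) {i j : ℤ} {p q : ℕ} (hp : p < (omega (x (i, j))).width)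
    (hq : q < (omega (x (i, j))).height) : Wide (y (c i + p, r j + q)) ↔ p = 0 := by
  rw [h.letter i j p q hp hq]; exact wide_img _ _ hp _ hq

theorem tall_iff (h : IsImage x y c r) {i j : ℤ} {p q : ℕ} (hp : p < (omega (x (i, j))).width)
    (hq : q < (omega (x (i, j))).height) : Tall (y (c i + p, r j + q)) ↔ q = 0 := by
  rw [h.letter i j p q hp hq]; exact tall_img _ _ hp _ hq

/-- The cut positions of an image can be read off: they are the wide columns. -/
theorem enumerates_col (h : IsImage x y c r) : Enumerates (fun n => Wide (y (n, 0))) c := by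
  intro i
  have hq : 0 < (omega (x (i, 0))).height := by have := height_omega (x (i, 0)); lia
  have hw := width_omega (x (i, 0))
  have h1 := h.wide_iff (i := i) (j := 0) (p := 0) (q := 0) (by lia) hq
  have h2 := h.col_succ i 0
  simp only [h.row_zero, Nat.cast_zero, add_zero, iff_true] at h1
  refine ⟨h1, hw.imp (fun hw => by lia) fun hw => ⟨by lia, ?_⟩⟩
  have h3 := h.wide_iff (i := i) (j := 0) (p := 1) (q := 0) (by lia) hq
  simpa [h.row_zero] using h3

theorem enumerates_row (h : IsImage x y c r) : Enumerates (fun n => Tall (y (0, n))) r := by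
  intro j
  have hp : 0 < (omega (x (0, j))).width := by have := width_omega (x (0, j)); lia
  have hw := height_omega (x (0, j))
  have h1 := h.tall_iff (i := 0) (j := j) (p := 0) (q := 0) hp (by lia)
  have h2 := h.row_succ 0 j
  simp only [h.col_zero, Nat.cast_zero, add_zero, iff_true] at h1
  refine ⟨h1, hw.imp (fun hw => by lia) fun hw => ⟨by lia, ?_⟩⟩
  have h3 := h.tall_iff (i := 0) (j := j) (p := 0) (q := 1) hp (by lia)
  simpa [h.col_zero] using h3

/-- Every cell of an image lies in the image of some letter. -/
theorem exists_cell (h : IsImage x y c r) (n : ℤ × ℤ) : ∃ i j, ∃ p q : ℕ,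
    p < (omega (x (i, j))).width ∧ q < (omega (x (i, j))).height ∧ n = (c i + p, r j + q) := by
  obtain ⟨i, h1, h2⟩ := exists_gap h.enumerates_col.strictMono n.1
  obtain ⟨j, h3, h4⟩ := exists_gap h.enumerates_row.strictMono n.2
  rw [h.col_succ i j] at h2
  rw [h.row_succ i j] at h4
  exact ⟨i, j, (n.1 - c i).toNat, (n.2 - r j).toNat, by lia, by lia, by ext <;> simp [h1, h3]⟩

theorem cuts_unique (h : IsImage x y c r) (h' : IsImage x' y c' r') : c = c' ∧ r = r' :=
  ⟨h.enumerates_col.unique h'.enumerates_col (h.col_zero.trans h'.col_zero.symm),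
    h.enumerates_row.unique h'.enumerates_row (h.row_zero.trans h'.row_zero.symm)⟩

theorem preimage_unique (h : IsImage x y c r) (h' : IsImage x' y c' r') : x = x' := by
  obtain ⟨rfl, rfl⟩ := h.cuts_unique h'
  funext ⟨i, j⟩
  have hw : (omega (x (i, j))).width = (omega (x' (i, j))).width := by
    have := h.col_succ i j; have := h'.col_succ i j; lia
  have hh : (omega (x (i, j))).height = (omega (x' (i, j))).height := by
    have := h.row_succ i j; have := h'.row_succ i j; lia
  exact img_injective _ _ hw hh fun p hp q hq =>
    (h.letter i j p q hp hq).symm.trans (h'.letter i j p q (hw ▸ hp) (hh ▸ hq))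

theorem image_unique {y' : Config (Fin 19)} (h : IsImage x y c r) (h' : IsImage x y' c' r') :
    y = y' := by
  have hc : c = c' := by
    funext i
    induction i using Int.induction_on with
    | zero => rw [h.col_zero, h'.col_zero]
    | succ i ih => rw [h.col_succ i 0, h'.col_succ i 0, ih]
    | pred i ih =>
      have := h.col_succ (-(i : ℤ) - 1) 0
      have := h'.col_succ (-(i : ℤ) - 1) 0
      simp only [sub_add_cancel] at *
      lia
  have hr : r = r' := by
    funext j
    induction j using Int.induction_on with
    | zero => rw [h.row_zero, h'.row_zero]
    | succ j ih => rw [h.row_succ 0 j, h'.row_succ 0 j, ih]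
    | pred j ih =>
      have := h.row_succ 0 (-(j : ℤ) - 1)
      have := h'.row_succ 0 (-(j : ℤ) - 1)
      simp only [sub_add_cancel] at *
      lia
  subst hc hr
  funext n
  obtain ⟨i, j, p, q, hp, hq, rfl⟩ := h.exists_cell n
  rw [h.letter i j p q hp hq, h'.letter i j p q hp hq]

/-- Inside of the image of a letter, adjacent cells always match; at its right border they match
if the letter matches its right neighbour. -/
theorem hMatch (h : IsImage x y c r) {i j : ℤ} {p q : ℕ} (hp : p < (omega (x (i, j))).width)
    (hq : q < (omega (x (i, j))).height)
    (hx : p + 1 = (omega (x (i, j))).width → HMatch (x (i, j)) (x (i + 1, j))) :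
    HMatch (y (c i + p, r j + q)) (y (c i + p + 1, r j + q)) := by
  rw [h.letter i j p q hp hq]
  obtain h1 | h1 : p + 1 < (omega (x (i, j))).width ∨ p + 1 = (omega (x (i, j))).width := by lia
  · have := h.letter i j (p + 1) q h1 hq
    rw [Nat.cast_add, Nat.cast_one, ← add_assoc] at this
    rw [this]
    exact hMatch_img _ _ hp _ hq h1
  · have hm := hx h1
    have h2 := width_omega (x (i + 1, j))
    have := h.letter (i + 1) j 0 q (by lia) (by rwa [← height_eq_of_hMatch _ _ hm])
    rw [h.col_succ i j, ← h1] at this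
    push_cast at this
    rw [add_zero, ← add_assoc] at this
    rw [this]
    exact hMatch_img_img _ _ hm _ hp _ hq h1

theorem vMatch (h : IsImage x y c r) {i j : ℤ} {p q : ℕ} (hp : p < (omega (x (i, j))).width)
    (hq : q < (omega (x (i, j))).height)
    (hx : q + 1 = (omega (x (i, j))).height → VMatch (x (i, j)) (x (i, j + 1))) :
    VMatch (y (c i + p, r j + q)) (y (c i + p, r j + q + 1)) := by
  rw [h.letter i j p q hp hq]
  obtain h1 | h1 : q + 1 < (omega (x (i, j))).height ∨ q + 1 = (omega (x (i, j))).height := by lia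
  · have := h.letter i j p (q + 1) hp h1
    rw [Nat.cast_add, Nat.cast_one, ← add_assoc] at this
    rw [this]
    exact vMatch_img _ _ hp _ hq h1
  · have hm := hx h1
    have h2 := height_omega (x (i, j + 1))
    have := h.letter i (j + 1) p 0 (by rwa [← width_eq_of_vMatch _ _ hm]) (by lia)
    rw [h.row_succ i j, ← h1] at this
    push_cast at this
    rw [add_zero, ← add_assoc] at this
    rw [this]
    exact vMatch_img_img _ _ hm _ hp _ hq h1

end IsImage

/-! ### Tilings and their images -/

theorem mem_OmegaU_iff {x : Config (Fin 19)} : x ∈ OmegaU ↔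
    ∀ i j, HMatch (x (i, j)) (x (i + 1, j)) ∧ VMatch (x (i, j)) (x (i, j + 1)) := by
  simp [OmegaU, tilings, HMatch, VMatch, Prod.forall]

theorem isConsistent_of_mem {x : Config (Fin 19)} (hx : x ∈ OmegaU) : IsConsistent x :=
  fun i j => ⟨(width_eq_of_vMatch _ _ (mem_OmegaU_iff.1 hx i j).2).symm,
    (height_eq_of_hMatch _ _ (mem_OmegaU_iff.1 hx i j).1).symm⟩

theorem IsImage.mem {x y : Config (Fin 19)} {c r : ℤ → ℤ} (h : IsImage x y c r) (hx : x ∈ OmegaU) :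
    y ∈ OmegaU := by
  refine mem_OmegaU_iff.2 fun n m => ?_
  obtain ⟨i, j, p, q, hp, hq, hn⟩ := h.exists_cell (n, m)
  obtain ⟨rfl, rfl⟩ := Prod.ext_iff.1 hn
  exact ⟨h.hMatch hp hq fun _ => (mem_OmegaU_iff.1 hx i j).1,
    h.vMatch hp hq fun _ => (mem_OmegaU_iff.1 hx i j).2⟩

theorem isMorphism_omega : IsMorphism omega OmegaU OmegaU := by
  intro x hx
  obtain ⟨y, c, r, h⟩ := (isConsistent_of_mem hx).exists_image
  refine ⟨y, h.mem hx, isConfigImage_omega_iff.2 ⟨c, r, h⟩, fun z hz => ?_⟩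
  obtain ⟨c', r', h'⟩ := isConfigImage_omega_iff.1 hz
  exact h'.image_unique h

theorem shift_mem {x : Config (Fin 19)} (hx : x ∈ OmegaU) (n : ℤ × ℤ) : shift n x ∈ OmegaU := by
  intro m
  have := hx (m + n)
  simpa only [shift, add_right_comm] using this

theorem shift_shift {A : Type*} (m n : ℤ × ℤ) (x : Config A) :
    shift m (shift n x) = shift (m + n) x := by
  funext k; simp [shift, add_assoc]

theorem shift_neg_shift {A : Type*} (n : ℤ × ℤ) (x : Config A) : shift (-n) (shift n x) = x := by
  rw [shift_shift]; funext k; simp [shift]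

/-! ### Desubstitution -/

theorem wide_or_wide {x : Config (Fin 19)} (hx : x ∈ OmegaU) (i j : ℤ) :
    Wide (x (i, j)) ∨ Wide (x (i + 1, j)) :=
  wide_or_wide_of_hMatch _ _ (mem_OmegaU_iff.1 hx i j).1

theorem tall_or_tall {x : Config (Fin 19)} (hx : x ∈ OmegaU) (i j : ℤ) :
    Tall (x (i, j)) ∨ Tall (x (i, j + 1)) := by
  by_contra! hc
  have H := fun k l => (mem_OmegaU_iff.1 hx k l).1
  have V := fun k => (mem_OmegaU_iff.1 hx k j).2
  exact tall_or_tall_of_row _ _ (V i) hc.1 hc.2 _ (H _ _) _ (H _ _) (V _) _ (H _ _) _ (H _ _) (V _)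
    _ (H _ _) _ (H _ _) (V _) _ (H _ _) _ (H _ _) (V _)

theorem exists_isBlock_of_mem {x : Config (Fin 19)} (hx : x ∈ OmegaU) {i j : ℤ}
    (hw : Wide (x (i, j))) (ht : Tall (x (i, j))) :
    ∃ a, IsBlock a (x (i, j)) (x (i, j + 1)) (x (i + 1, j)) (x (i + 1, j + 1)) := by
  have H := fun k l => (mem_OmegaU_iff.1 hx k l).1
  have V := fun k l => (mem_OmegaU_iff.1 hx k l).2
  have H' : ∀ l, HMatch (x (i - 1, l)) (x (i, l)) := fun l => by simpa using H (i - 1) l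
  have V' : ∀ k, VMatch (x (k, j - 1)) (x (k, j)) := fun k => by simpa using V k (j - 1)
  refine (exists_isBlock _ hw ht _ (H _ _) _ (V _ _) _ (H _ _) (V _ _)).resolve_right fun hc => ?_
  exact hc _ (H' _) _ (H' _) (V _ _) _ (V' _) _ (H' _) (V' _) _ (H _ _) (V' _) _ (H _ _) _ (H _ _)
    (V _ _) _ (H _ _) (V' _)

/-- A tiling cut at the origin, in both directions, is the image of a tiling. -/
theorem exists_isImage {y : Config (Fin 19)} (hy : y ∈ OmegaU) (hw : Wide (y 0)) (ht : Tall (y 0)) :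
    ∃ x ∈ OmegaU, ∃ c r, IsImage x y c r := by
  obtain ⟨c, hc0, hc⟩ := exists_enumerates (P := fun n => Wide (y (n, 0)))
    (fun n => wide_or_wide hy n 0) hw
  obtain ⟨r, hr0, hr⟩ := exists_enumerates (P := fun n => Tall (y (0, n)))
    (fun n => tall_or_tall hy 0 n) ht
  have W : ∀ n m, Wide (y (n, m)) ↔ Wide (y (n, 0)) := fun n m => by
    rw [Wide, (isConsistent_of_mem hy).width_eq]
  have T : ∀ n m, Tall (y (n, m)) ↔ Tall (y (0, m)) := fun n m => by
    rw [Tall, (isConsistent_of_mem hy).height_eq]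
  choose x hx using fun i j => exists_isBlock_of_mem hy (i := c i) (j := r j)
    ((W _ _).2 (hc i).1) ((T _ _).2 (hr j).1)
  have h : IsImage (fun n => x n.1 n.2) y c r := by
    refine ⟨hc0, hr0, fun i j => ?_, fun i j => ?_, fun i j p q hp hq => ?_⟩
    · obtain ⟨h1, -⟩ := hx i j
      have h2 := (hc (i + 1)).1
      simp only [W _ (r j)] at h1
      dsimp only
      obtain h3 | ⟨h3, h4⟩ := (hc i).2
      · rw [h3] at h2
        rw [h1, if_pos h2, h3, Nat.cast_one]
      · rw [h1, if_neg h4, h3, Nat.cast_two]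
    · obtain ⟨-, h1, -⟩ := hx i j
      have h2 := (hr (j + 1)).1
      simp only [T (c i)] at h1
      dsimp only
      obtain h3 | ⟨h3, h4⟩ := (hr j).2
      · rw [h3] at h2
        rw [h1, if_pos h2, h3, Nat.cast_one]
      · rw [h1, if_neg h4, h3, Nat.cast_two]
    · obtain ⟨-, -, h1⟩ := hx i j
      dsimp only at hp hq ⊢
      rw [h1 p hp q hq]
      have hp2 : p < 2 := by have := width_omega (x i j); lia
      have hq2 : q < 2 := by have := height_omega (x i j); lia
      interval_cases p <;> interval_cases q <;> simp
  refine ⟨_, mem_OmegaU_iff.2 fun i j => ⟨?_, ?_⟩, c, r, h⟩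
  · have hh : (omega (x i j)).height = (omega (x (i + 1) j)).height := by
      have h1 := h.row_succ i j; have h2 := h.row_succ (i + 1) j; dsimp only at h1 h2; lia
    refine hMatch_of_img _ _ hh fun q hq => ?_
    dsimp only at hq ⊢
    have hw1 := width_omega (x i j)
    have hw2 := width_omega (x (i + 1) j)
    have e1 := h.letter i j ((omega (x i j)).width - 1) q (by dsimp only; lia) hq
    have e2 := h.letter (i + 1) j 0 q (by dsimp only; lia) (hh ▸ hq)
    have e3 := (mem_OmegaU_iff.1 hy (c i + ((omega (x i j)).width - 1 : ℕ)) (r j + q)).1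
    rw [e1] at e3
    rw [show c (i + 1) + (0 : ℕ) = c i + ((omega (x i j)).width - 1 : ℕ) + 1 by
      have := h.col_succ i j; dsimp only at this; lia] at e2
    rwa [e2] at e3
  · have hh : (omega (x i j)).width = (omega (x i (j + 1))).width := by
      have h1 := h.col_succ i j; have h2 := h.col_succ i (j + 1); dsimp only at h1 h2; lia
    refine vMatch_of_img _ _ hh fun p hp => ?_
    dsimp only at hp ⊢
    have hw1 := height_omega (x i j)
    have hw2 := height_omega (x i (j + 1))
    have e1 := h.letter i j p ((omega (x i j)).height - 1) hp (by dsimp only; lia)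
    have e2 := h.letter i (j + 1) p 0 (hh ▸ hp) (by dsimp only; lia)
    have e3 := (mem_OmegaU_iff.1 hy (c i + p) (r j + ((omega (x i j)).height - 1 : ℕ))).2
    rw [e1] at e3
    rw [show r (j + 1) + (0 : ℕ) = r j + ((omega (x i j)).height - 1 : ℕ) + 1 by
      have := h.row_succ i j; dsimp only at this; lia] at e2
    rwa [e2] at e3

/-- Every tiling is, up to a shift, the image of a tiling. -/
theorem exists_shift_isImage {y : Config (Fin 19)} (hy : y ∈ OmegaU) :
    ∃ s : ℤ × ℤ, ∃ x ∈ OmegaU, ∃ c r, IsImage x (shift s y) c r := by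
  obtain ⟨s, hs⟩ : ∃ s, Wide (y (s, 0)) := (wide_or_wide hy 0 0).elim (⟨_, ·⟩) (⟨_, ·⟩)
  obtain ⟨t, ht⟩ : ∃ t, Tall (y (s, t)) := (tall_or_tall hy s 0).elim (⟨_, ·⟩) (⟨_, ·⟩)
  refine ⟨(s, t), exists_isImage (shift_mem hy _) ?_ ?_⟩
  · rw [shift, zero_add, Wide, (isConsistent_of_mem hy).width_eq]; exact hs
  · rw [shift, zero_add]; exact ht

theorem imageShiftClosure_omega : imageShiftClosure omega OmegaU = OmegaU := by
  ext y
  constructor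
  · rintro ⟨k, x, hx, z, hz, rfl⟩
    obtain ⟨c, r, h⟩ := isConfigImage_omega_iff.1 hz
    exact shift_mem (h.mem hx) k
  · intro hy
    obtain ⟨s, x, hx, c, r, h⟩ := exists_shift_isImage hy
    exact ⟨-s, x, hx, _, isConfigImage_omega_iff.2 ⟨c, r, h⟩, (shift_neg_shift s y).symm⟩

/-! ### Recognizability -/

/-- The offset of a centered representation is told by whether the tile at the origin is wide and
whether it is tall. -/
theorem centered_offset {x y : Config (Fin 19)} {k : ℤ × ℤ}
    (h : IsCenteredRepresentation omega k x y) :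
    k = (if Wide (y 0) then 0 else 1, if Tall (y 0) then 0 else 1) := by
  obtain ⟨⟨z, hz, rfl⟩, h1, h2, h3, h4⟩ := h
  obtain ⟨c, r, h⟩ := isConfigImage_omega_iff.1 hz
  obtain ⟨k₁, k₂⟩ := k
  lift k₁ to ℕ using h1
  lift k₂ to ℕ using h3
  have hp : k₁ < (omega (x (0, 0))).width := by dsimp only at h2; exact_mod_cast h2
  have hq : k₂ < (omega (x (0, 0))).height := by dsimp only at h4; exact_mod_cast h4
  have e1 := h.wide_iff hp hq
  have e2 := h.tall_iff hp hq
  rw [h.col_zero, h.row_zero, zero_add, zero_add] at e1 e2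
  have hw := width_omega (x (0, 0))
  have hh := height_omega (x (0, 0))
  simp only [shift, zero_add, e1, e2]
  ext <;> dsimp only <;> split_ifs <;> lia

theorem isRecognizable_omega : IsRecognizable omega OmegaU := by
  intro y k k' x x' _ _ h h'
  obtain rfl : k = k' := (centered_offset h).trans (centered_offset h').symm
  obtain ⟨⟨z, hz, rfl⟩, -⟩ := h
  obtain ⟨⟨z', hz', e⟩, -⟩ := h'
  obtain rfl : z = z' := by rw [← shift_neg_shift k z, e, shift_neg_shift]
  obtain ⟨c, r, h⟩ := isConfigImage_omega_iff.1 hz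
  obtain ⟨c', r', h'⟩ := isConfigImage_omega_iff.1 hz'
  exact ⟨rfl, h.preimage_unique h'⟩

/-! ### Absence of periods -/

theorem eq_zero_of_shift_eq {y : Config (Fin 19)} (hy : y ∈ OmegaU) (n : ℤ × ℤ)
    (hn : shift n y = y) : n = 0 := by
  -- Descent: a nonzero period of `y` gives a shorter nonzero period of its preimage under `ω`.
  induction hN : n.1.natAbs + n.2.natAbs using Nat.strong_induction_on generalizing y n with
  | _ N ih =>
  obtain ⟨s, x, hx, c, r, h⟩ := exists_shift_isImage hy
  obtain ⟨a, b⟩ := n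
  generalize hz : shift s y = z at h
  have hzm : z ∈ OmegaU := hz ▸ shift_mem hy s
  have hzn : ∀ i j, z (i + a, j + b) = z (i, j) := fun i j => by
    have : shift (a, b) z = z := by rw [← hz, shift_shift, add_comm, ← shift_shift, hn]
    exact congrFun this (i, j)
  have hzc := isConsistent_of_mem hzm
  obtain ⟨a', ha⟩ := h.enumerates_col.exists_period h.col_zero (a := a) fun n => by
    rw [Wide, Wide, ← hzc.width_eq (n + a) (0 + b), hzn]
  obtain ⟨b', hb⟩ := h.enumerates_row.exists_period h.row_zero (a := b) fun n => by
    rw [Tall, Tall, ← hzc.height_eq (0 + a) (n + b), hzn]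
  have hx' : IsImage (shift (a', b') x) z c r := by
    refine ⟨h.col_zero, h.row_zero, fun i j => ?_, fun i j => ?_, fun i j p q hp hq => ?_⟩
    · have := h.col_succ (i + a') (j + b')
      rw [add_right_comm, ha, ha] at this
      simp only [shift, Prod.mk_add_mk]
      lia
    · have := h.row_succ (i + a') (j + b')
      rw [add_right_comm, hb, hb] at this
      simp only [shift, Prod.mk_add_mk]
      lia
    · have := h.letter (i + a') (j + b') p q hp hq
      rw [ha, hb, add_right_comm, add_right_comm (r j), hzn] at this
      exact this
  have h1 := h.enumerates_col.period_lt h.col_zero (fun i => by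
    have e1 := h.col_succ i 0
    have e2 := h.col_succ (i + 1) 0
    have e3 := wide_or_wide hx i 0
    have e4 := width_omega (x (i, 0))
    have e5 := width_omega (x (i + 1, 0))
    rw [add_assoc] at e2
    simp only [Wide, Int.reduceAdd] at *
    lia) ha
  have h2 := h.enumerates_row.period_lt h.row_zero (fun i => by
    have e1 := h.row_succ 0 i
    have e2 := h.row_succ 0 (i + 1)
    have e3 := tall_or_tall hx 0 i
    have e4 := height_omega (x (0, i))
    have e5 := height_omega (x (0, i + 1))
    rw [add_assoc] at e2
    simp only [Tall, Int.reduceAdd] at *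
    lia) hb
  by_contra hne
  have hlt : a'.natAbs + b'.natAbs < N := by
    simp only [Prod.mk_eq_zero] at hne
    dsimp only at hN
    lia
  have h3 := ih _ hlt hx (a', b') (hx'.preimage_unique h) rfl
  simp only [Prod.mk_eq_zero] at h3 hne
  lia

/-! ### Iterated images of letters: expansivity and existence of tilings -/

/-- The rectangle of shape `(w, h)` of a configuration with lower left corner at the origin. -/
def window (x : Config (Fin 19)) (w h : ℕ) : Word2 (Fin 19) := ⟨w, h, fun i j => x (i, j)⟩

/-- The tiles in the rectangle of shape `(w, h)` with lower left corner at the origin match. -/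
def MatchesOn (x : Config (Fin 19)) (w h : ℕ) : Prop :=
  ∀ i j : ℤ, 0 ≤ i → i < w → 0 ≤ j → j < h →
    (i + 1 < w → HMatch (x (i, j)) (x (i + 1, j))) ∧
    (j + 1 < h → VMatch (x (i, j)) (x (i, j + 1)))

namespace IsImage

variable {x y : Config (Fin 19)} {c r : ℤ → ℤ}

theorem wide_iff_mem_range (h : IsImage x y c r) (n m : ℤ) : Wide (y (n, m)) ↔ ∃ i, c i = n := by
  obtain ⟨i, j, p, q, hp, hq, e⟩ := h.exists_cell (n, m)
  obtain ⟨rfl, rfl⟩ := Prod.ext_iff.1 e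
  dsimp only
  rw [h.wide_iff hp hq]
  refine ⟨fun hp0 => ⟨i, by simp [hp0]⟩, fun ⟨i', hi'⟩ => ?_⟩
  have hc := h.enumerates_col.strictMono
  have := h.col_succ i j
  have := hc (lt_add_one i')
  obtain rfl : i = i' := gap_unique hc (n := c i + p) (by lia) (by lia) (by lia) (by lia)
  lia

theorem tall_iff_mem_range (h : IsImage x y c r) (n m : ℤ) : Tall (y (n, m)) ↔ ∃ j, r j = m := by
  obtain ⟨i, j, p, q, hp, hq, e⟩ := h.exists_cell (n, m)
  obtain ⟨rfl, rfl⟩ := Prod.ext_iff.1 e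
  dsimp only
  rw [h.tall_iff hp hq]
  refine ⟨fun hp0 => ⟨j, by simp [hp0]⟩, fun ⟨j', hj'⟩ => ?_⟩
  have hr := h.enumerates_row.strictMono
  have := h.row_succ i j
  have := hr (lt_add_one j')
  obtain rfl : j = j' := gap_unique hr (n := r j + q) (by lia) (by lia) (by lia) (by lia)
  lia

/-- An image under `ω` can be substituted again, whether or not its tiles match. -/
theorem isConsistent (h : IsImage x y c r) : IsConsistent y := by
  intro n m
  have h1 := (h.wide_iff_mem_range n (m + 1)).trans (h.wide_iff_mem_range n m).symm
  have h2 := (h.tall_iff_mem_range (n + 1) m).trans (h.tall_iff_mem_range n m).symm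
  have := width_omega (y (n, m))
  have := width_omega (y (n, m + 1))
  have := height_omega (y (n, m))
  have := height_omega (y (n + 1, m))
  simp only [Wide, Tall] at h1 h2
  constructor <;> lia

theorem col_natCast (h : IsImage x y c r) (n : ℕ) : ((c n).toNat : ℤ) = c n := by
  have := h.enumerates_col.add_le 0 n
  rw [h.col_zero, zero_add] at this
  lia

theorem row_natCast (h : IsImage x y c r) (n : ℕ) : ((r n).toNat : ℤ) = r n := by
  have := h.enumerates_row.add_le 0 n
  rw [h.row_zero, zero_add] at this
  lia

theorem matchesOn (h : IsImage x y c r) {w l : ℕ} (hx : MatchesOn x w l) :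
    MatchesOn y (c w).toNat (r l).toNat := by
  intro n m hn0 hn hm0 hm
  rw [h.col_natCast] at *
  rw [h.row_natCast] at *
  obtain ⟨i, j, p, q, hp, hq, e⟩ := h.exists_cell (n, m)
  obtain ⟨rfl, rfl⟩ := Prod.ext_iff.1 e
  dsimp only at *
  have hc := h.enumerates_col.strictMono
  have hr := h.enumerates_row.strictMono
  have ec := h.col_succ i j
  have er := h.row_succ i j
  have hi : i < w := hc.lt_iff_lt.1 (by lia)
  have hj : j < l := hr.lt_iff_lt.1 (by lia)
  have hi0 : 0 < i + 1 := hc.lt_iff_lt.1 (by rw [h.col_zero]; lia)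
  have hj0 : 0 < j + 1 := hr.lt_iff_lt.1 (by rw [h.row_zero]; lia)
  have hxm := hx i j (by lia) hi (by lia) hj
  exact ⟨fun hlt => h.hMatch hp hq fun hb => hxm.1 (hc.lt_iff_lt.1 (by lia)),
    fun hlt => h.vMatch hp hq fun hb => hxm.2 (hr.lt_iff_lt.1 (by lia))⟩

theorem isWordImage (h : IsImage x y c r) (w l : ℕ) :
    IsWordImage omega (window x w l) (window y (c w).toNat (r l).toNat) := by
  refine ⟨fun n => (c n).toNat, fun n => (r n).toNat, by simp [h.col_zero], by simp [h.row_zero],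
    rfl, rfl, fun ⟨i, hi⟩ ⟨j, hj⟩ => ?_⟩
  replace hi : i < w := hi
  replace hj : j < l := hj
  have ec := h.col_succ i j
  have er := h.row_succ i j
  have c1 := h.col_natCast i
  have c2 := h.col_natCast (i + 1)
  have cw := h.col_natCast w
  have r1 := h.row_natCast j
  have r2 := h.row_natCast (j + 1)
  have rl := h.row_natCast l
  have cm := h.enumerates_col.strictMono.monotone (show (i : ℤ) + 1 ≤ w by lia)
  have rm := h.enumerates_row.strictMono.monotone (show (j : ℤ) + 1 ≤ l by lia)
  push_cast at c2 r2
  dsimp only [window]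
  push_cast
  refine ⟨by lia, by lia, by dsimp only; lia, by dsimp only; lia, fun p q => ?_⟩
  have := h.letter i j p q p.2 q.2
  rw [img_eq_letter] at this
  dsimp only at this ⊢
  push_cast
  rw [← this, c1, r1]

end IsImage

/-- The word `ω^m(a)`: its tiles match, and both of its dimensions are at least `m`, since from
`m = 1` on the letter in the lower left corner is wide and tall. -/
theorem exists_isIterate (a : Fin 19) (m : ℕ) : ∃ y w l, IsConsistent y ∧ MatchesOn y w l ∧
    IsIterate omega a m (window y w l) ∧ 1 ≤ w ∧ 1 ≤ l ∧ m ≤ w ∧ m ≤ l ∧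
    (1 ≤ m → Wide (y (0, 0)) ∧ Tall (y (0, 0))) := by
  induction m with
  | zero =>
    refine ⟨fun _ => a, 1, 1, fun i j => ⟨rfl, rfl⟩, ?_, rfl, le_rfl, le_rfl, by simp, by simp,
      by simp⟩
    intro i j hi hi' hj hj'
    constructor <;> intro h <;> lia
  | succ m ih =>
    obtain ⟨x, w, l, hx, hm, hit, hw, hl, hmw, hml, hcor⟩ := ih
    obtain ⟨y, c, r, h⟩ := hx.exists_image
    have hw0 := width_omega (x (0, 0))
    have hh0 := height_omega (x (0, 0))
    have c0 := h.col_succ 0 0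
    have r0 := h.row_succ 0 0
    have cw := h.enumerates_col.add_le 1 (w - 1)
    have rl := h.enumerates_row.add_le 1 (l - 1)
    rw [show 1 + ((w - 1 : ℕ) : ℤ) = w by lia] at cw
    rw [show 1 + ((l - 1 : ℕ) : ℤ) = l by lia] at rl
    rw [h.col_zero, zero_add, zero_add] at c0
    rw [h.row_zero, zero_add, zero_add] at r0
    refine ⟨y, (c w).toNat, (r l).toNat, h.isConsistent, h.matchesOn hm,
      ⟨_, hit, h.isWordImage w l⟩, by lia, by lia, ?_, ?_, fun _ => ?_⟩
    · rcases Nat.eq_zero_or_pos m with rfl | hpos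
      · lia
      · have := (hcor hpos).1
        simp only [Wide] at this
        lia
    · rcases Nat.eq_zero_or_pos m with rfl | hpos
      · lia
      · have := (hcor hpos).2
        simp only [Tall] at this
        lia
    · have h1 := h.wide_iff (i := 0) (j := 0) (p := 0) (q := 0) (by lia) (by lia)
      have h2 := h.tall_iff (i := 0) (j := 0) (p := 0) (q := 0) (by lia) (by lia)
      simp only [h.col_zero, h.row_zero, Nat.cast_zero, add_zero, iff_true] at h1 h2
      exact ⟨h1, h2⟩

theorem isExpansive_omega : IsExpansive omega := by
  intro a K
  obtain ⟨y, w, l, -, -, h, -, -, hw, hl, -⟩ := exists_isIterate a (K + 1)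
  exact ⟨K + 1, _, h, by simp only [window]; lia⟩

theorem isClosed_setOf_match (n : ℤ × ℤ) :
    IsClosed {x : Config (Fin 19) |
      HMatch (x n) (x (n + (1, 0))) ∧ VMatch (x n) (x (n + (0, 1)))} := by
  have h : Continuous fun x : Config (Fin 19) => (x n, x (n + (1, 0)), x (n + (0, 1))) := by
    fun_prop
  exact (isClosed_discrete
    {t : Fin 19 × Fin 19 × Fin 19 | HMatch t.1 t.2.1 ∧ VMatch t.1 t.2.2}).preimage h

theorem OmegaU_eq_iInter : OmegaU = ⋂ n : ℤ × ℤ,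
    {x : Config (Fin 19) | HMatch (x n) (x (n + (1, 0))) ∧ VMatch (x n) (x (n + (0, 1)))} := by
  ext x; simp [OmegaU, tilings, HMatch, VMatch]

theorem isSubshift_OmegaU : IsSubshift OmegaU := by
  refine ⟨fun n => Set.Subset.antisymm ?_ fun x hx => ?_, ?_⟩
  · rintro _ ⟨x, hx, rfl⟩
    exact shift_mem hx n
  · exact ⟨shift (-n) x, shift_mem hx _, by simpa using shift_neg_shift (-n) x⟩
  · -- The topology of `Fin 19` is by definition the discrete one.
    change IsClosed OmegaU
    rw [OmegaU_eq_iInter]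
    exact isClosed_iInter isClosed_setOf_match

/-- Tilings exist by compactness, as the words `ω^m(a)` tile arbitrarily large squares. -/
theorem OmegaU_nonempty : OmegaU.Nonempty := by
  rw [OmegaU_eq_iInter, ← Set.univ_inter (⋂ n, _)]
  refine isCompact_univ.inter_iInter_nonempty _ isClosed_setOf_match fun u => ?_
  let k := u.sup fun n => max n.1.natAbs n.2.natAbs
  obtain ⟨y, w, l, -, hm, -, -, -, hw, hl, -⟩ := exists_isIterate 0 (2 * k + 2)
  -- The positions in `u` and their neighbours lie in the square `[-k, k + 1]²`.
  refine ⟨shift (k, k) y, trivial, Set.mem_iInter₂.2 fun n hn => ?_⟩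
  have hk : max n.1.natAbs n.2.natAbs ≤ k :=
    Finset.le_sup (f := fun n : ℤ × ℤ => max n.1.natAbs n.2.natAbs) hn
  have h := hm (n.1 + k) (n.2 + k) (by lia) (by lia) (by lia) (by lia)
  have h1 := h.1 (by lia)
  have h2 := h.2 (by lia)
  rw [add_right_comm] at h1 h2
  obtain ⟨i, j⟩ := n
  simpa only [Set.mem_ofPred_eq, shift, Prod.mk_add_mk, add_zero] using And.intro h1 h2

theorem isAperiodic_OmegaU : IsAperiodic OmegaU :=
  ⟨OmegaU_nonempty, fun _ hx n hn h => hn (eq_zero_of_shift_eq hx n h)⟩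

end WangShift

/-- The morphism `ω` maps `Ω_𝒰` to itself, `Ω_𝒰` is the shift-closure of `ω(Ω_𝒰)`,
`Ω_𝒰` is self-similar, `ω` is expansive and recognizable in `Ω_𝒰`, and `Ω_𝒰` is aperiodic. -/
theorem mainTheorem7 :
    WangShift.IsMorphism WangShift.omega WangShift.OmegaU WangShift.OmegaU ∧
    WangShift.imageShiftClosure WangShift.omega WangShift.OmegaU = WangShift.OmegaU ∧
    WangShift.IsSelfSimilar WangShift.OmegaU ∧
    WangShift.IsExpansive WangShift.omega ∧
    WangShift.IsRecognizable WangShift.omega WangShift.OmegaU ∧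
    WangShift.IsAperiodic WangShift.OmegaU :=
  ⟨WangShift.isMorphism_omega, WangShift.imageShiftClosure_omega,
    ⟨WangShift.isSubshift_OmegaU, WangShift.omega, WangShift.isExpansive_omega,
      WangShift.isMorphism_omega, WangShift.imageShiftClosure_omega⟩,
    WangShift.isExpansive_omega, WangShift.isRecognizable_omega, WangShift.isAperiodic_OmegaU⟩
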